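/- Let $\mathbb{R}_{\mathrm{ext}}$ be the totally ordered set consisting of all real numbers $x$ together with a symbol $x^+$ for every real number $x$, where $x^+$ covers $x$ and, for all real $x,y$, the inequalities $y<x^+$ and $y\le x$ are equivalent. A word $w=w_1\cdots w_n$ has period $p\ge 1$ if $w_{i+p}=w_i$ for all $1\le i\le n-p$; the exponent of $w$ is its length divided by its least period. For $\beta\in\mathbb{R}_{\mathrm{ext}}$, a word is $\beta$-free if none of its factors (contiguous subwords) has exponent $\ge\beta$ (so $b^+$-free means that no factor has exponent $>b$). A word $w$ over an alphabet $\Sigma$ is extremal $\beta$-free if $w$ is $\beta$-free and, for every factorization $w=w'w''$ with $w',w''$ possibly empty and every letter $a\in\Sigma$, the word $w'aw''$ contains a factor of exponent $\ge\beta$. **Theorem.** Let $\beta\in\mathbb{R}_{\mathrm{ext}}$ satisfy $2^+\le\beta\le 8/3$. Then there are arbitrarily long extremal $\beta$-free words over the binary alphabet $\{0,1\}$; that is, for every $N$ there is an extremal $\beta$-free word over $\{0,1\}$ of length at least $N$. -/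

import Mathlib

/-- The ordered set `ℝ_ext` of real numbers `x` and real numbers with a plus `x⁺`:
`(x, false)` stands for `x` and `(x, true)` for `x⁺`, ordered lexicographically. -/
abbrev ExtReal : Type := ℝ ×ₗ Bool

namespace ExtReal

/-- The real number `x` as an extended real number. -/
def real (x : ℝ) : ExtReal := toLex (x, false)

/-- The extended real number `x⁺`. -/
def plus (x : ℝ) : ExtReal := toLex (x, true)

/-- `y < x⁺` and `y ≤ x` are equivalent. -/
theorem real_lt_plus_iff (x y : ℝ) : real y < plus x ↔ y ≤ x := by
  simp [real, plus, Prod.Lex.toLex_lt_toLex, le_iff_lt_or_eq]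

/-- `x⁺` covers `x`. -/
theorem real_covBy_plus (x : ℝ) : real x ⋖ plus x := by
  simp [real, plus, Prod.Lex.toLex_covBy_toLex_iff]

end ExtReal

namespace Word

variable {α : Type*}

/-- *The* period of `w`: its least period `p ≥ 1`. The set is never empty, since every
`p ≥ w.length` is a period of `w`; the empty word has period `1`. -/
noncomputable def period (w : List α) : ℕ :=
  sInf {p : ℕ | 1 ≤ p ∧ w.HasPeriod p}

/-- The exponent of `w`: its length divided by its period. -/
noncomputable def exponent (w : List α) : ℝ :=
  (w.length : ℝ) / (period w : ℝ)

/-- Some factor (contiguous subword) of `w` has exponent at least `β`. -/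
def HasPower (β : ExtReal) (w : List α) : Prop :=
  ∃ u : List α, u <:+: w ∧ β ≤ ExtReal.real (exponent u)

/-- `w` is `β`-free: no factor of `w` has exponent at least `β`. -/
def IsFree (β : ExtReal) (w : List α) : Prop :=
  ¬ HasPower β w

/-- `x` is an extension of `w`: it is obtained from `w` by inserting one letter somewhere,
possibly at either end. -/
def IsExtension (w x : List α) : Prop :=
  ∃ (w₁ w₂ : List α) (a : α), w = w₁ ++ w₂ ∧ x = w₁ ++ a :: w₂

/-- `w` is extremal `β`-free: it is `β`-free, and every extension of `w` over the same alphabet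
has a factor of exponent at least `β`. -/
def IsExtremalFree (β : ExtReal) (w : List α) : Prop :=
  IsFree β w ∧ ∀ x : List α, IsExtension w x → HasPower β x

end Word

/-! The range of `β` is cut at `7/3`, `17/7` and `18/7`. Since `x⁺` covers `x`, each `β` lies in
some interval `[(c/d)⁺, e/f]` with consecutive endpoints among `2, 7/3, 17/7, 18/7, 8/3`. For such
an interval it suffices to find long words without factors of exponent above `c/d`, all of whose
extensions contain a power of exponent at least `e/f`.

The words have the form `P u P'`. Here `u` is a long factor of a sequence `W`, equal to its own
reversed complement, and `P'` is the reversed complement of `P`; by symmetry only the left half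
matters. `W` is the Thue–Morse sequence for the first interval and a 25-uniform image of it for the
others. Inserting a letter deep inside `W` always creates a large power, so `P` only has to block
insertions near the end.

The word stays power-free because `W` is (`thueMorse_overlap_free`, `seqPowFree_denseBlock`), and
because each position of `P` starts a short word that never occurs in `W`: a long-period power
starting in `P` would repeat that word inside `u`. What remains is a finite check on short windows
(`exists_extremal_of_checks`). -/

/-! ### The Thue–Morse sequence -/

/-- The Thue–Morse sequence: the parity of the number of ones in the binary expansion. -/
def thueMorse (n : ℕ) : Bool :=
  if n = 0 then false else xor (n % 2 == 1) (thueMorse (n / 2))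
termination_by n
decreasing_by omega

theorem thueMorse_zero : thueMorse 0 = false := by
  rw [thueMorse, if_pos rfl]

theorem thueMorse_two_mul (n : ℕ) : thueMorse (2 * n) = thueMorse n := by
  rcases Nat.eq_zero_or_pos n with rfl | hn
  · rfl
  · rw [thueMorse, if_neg (by omega)]
    simp

theorem thueMorse_two_mul_add_one (n : ℕ) : thueMorse (2 * n + 1) = !thueMorse n := by
  rw [thueMorse, if_neg (by omega), show (2 * n + 1) / 2 = n by omega,
    show (2 * n + 1) % 2 = 1 by omega]
  simp

/-- The Thue–Morse sequence has no overlaps. -/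
theorem thueMorse_overlap_free (k : ℕ) :
    ∀ i, 1 ≤ k → ¬ ∀ j ≤ k, thueMorse (i + j) = thueMorse (i + j + k) := by
  induction k using Nat.strong_induction_on with
  | _ k ih =>
    intro i hk H
    obtain ⟨k', rfl | rfl⟩ := Nat.even_or_odd' k
    · obtain ⟨i', rfl | rfl⟩ := Nat.even_or_odd' i
      · refine ih k' (by omega) i' (by omega) fun j hj => ?_
        have := H (2 * j) (by omega)
        rwa [show 2 * i' + 2 * j = 2 * (i' + j) by ring,
          show 2 * (i' + j) + 2 * k' = 2 * (i' + j + k') by ring,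
          thueMorse_two_mul, thueMorse_two_mul] at this
      · refine ih k' (by omega) i' (by omega) fun j hj => ?_
        have := H (2 * j) (by omega)
        rwa [show 2 * i' + 1 + 2 * j = 2 * (i' + j) + 1 by ring,
          show 2 * (i' + j) + 1 + 2 * k' = 2 * (i' + j + k') + 1 by ring,
          thueMorse_two_mul_add_one, thueMorse_two_mul_add_one, Bool.not_inj_iff] at this
    -- For an odd period, a pair starting at an odd position equals its translate at an even one,
    -- where adjacent letters always differ. So the factor alternates, which contradicts an odd
    -- period.
    · have alt : ∀ j, j < 2 * k' + 1 → thueMorse (i + (j + 1)) = !thueMorse (i + j) := by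
        intro j hj
        obtain ⟨m, hm | hm⟩ := Nat.even_or_odd' (i + j)
        · rw [← add_assoc, hm, thueMorse_two_mul_add_one, thueMorse_two_mul]
        · rw [H j (by omega), H (j + 1) (by omega),
            show i + (j + 1) + (2 * k' + 1) = 2 * (m + k' + 1) + 1 by omega,
            show i + j + (2 * k' + 1) = 2 * (m + k' + 1) by omega,
            thueMorse_two_mul_add_one, thueMorse_two_mul]
      have even : ∀ j, j ≤ k' → thueMorse (i + 2 * j) = thueMorse i := by
        intro j
        induction j with
        | zero => simp
        | succ j ihj =>
          intro hj
          rw [show i + 2 * (j + 1) = i + (2 * j + 1 + 1) by ring, alt _ (by omega),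
            alt _ (by omega), Bool.not_not, ihj (by omega)]
      have h0 := H 0 (by omega)
      rw [add_zero, alt (2 * k') (by omega), even k' le_rfl] at h0
      simp at h0

/-- Reversing a prefix of length `2 ^ n` of the Thue–Morse sequence complements it if `n` is odd,
and leaves it unchanged otherwise. -/
theorem thueMorse_mirror (n : ℕ) : ∀ a b, a + b + 1 = 2 ^ n →
    thueMorse b = xor (thueMorse a) (n % 2 == 1) := by
  induction n with
  | zero =>
    intro a b h
    obtain ⟨rfl, rfl⟩ : a = 0 ∧ b = 0 := by omega
    simp
  | succ n ih =>
    intro a b h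
    have hn : ((n + 1) % 2 == 1) = !(n % 2 == 1) := by
      rcases Nat.mod_two_eq_zero_or_one n with h | h <;> simp [Nat.add_mod, h]
    rw [pow_succ] at h
    rw [hn]
    obtain ⟨a', rfl | rfl⟩ := Nat.even_or_odd' a
    · obtain ⟨b', rfl | rfl⟩ := Nat.even_or_odd' b
      · omega
      · rw [thueMorse_two_mul, thueMorse_two_mul_add_one, ih a' b' (by omega)]
        simp
    · obtain ⟨b', rfl | rfl⟩ := Nat.even_or_odd' b
      · rw [thueMorse_two_mul, thueMorse_two_mul_add_one, ih a' b' (by omega)]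
        simp
      · omega

namespace Word

/-! ### Powers in words -/

/-- No factor of `w` with period `p` is longer than `c / d * p`. -/
def PowFree {α : Type*} (c d : ℕ) (w : List α) : Prop :=
  ∀ u, u <:+: w → ∀ p, 1 ≤ p → u.HasPeriod p → d * u.length ≤ c * p

/-- Some factor of `w` with period `p` has length at least `e / f * p`. -/
def HasPow {α : Type*} (e f : ℕ) (w : List α) : Prop :=
  ∃ u, u <:+: w ∧ ∃ p, 1 ≤ p ∧ u.HasPeriod p ∧ e * p ≤ f * u.length

theorem HasPow.mono {α : Type*} {e f : ℕ} {v w : List α} (h : v <:+: w) :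
    HasPow e f v → HasPow e f w :=
  fun ⟨u, hu, hp⟩ => ⟨u, hu.trans h, hp⟩

theorem HasPow.weaken {α : Type*} {e f e' f' : ℕ} {w : List α} (hf' : 0 < f')
    (h : e * f' ≤ e' * f) : HasPow e' f' w → HasPow e f w := by
  rintro ⟨u, hu, p, hp, hper, hl⟩
  refine ⟨u, hu, p, hp, hper, Nat.le_of_mul_le_mul_left ?_ hf'⟩
  calc f' * (e * p) = e * f' * p := by ring
    _ ≤ e' * f * p := Nat.mul_le_mul_right p h
    _ = f * (e' * p) := by ring
    _ ≤ f * (f' * u.length) := Nat.mul_le_mul_left f hl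
    _ = f' * (f * u.length) := by ring

theorem hasPeriod_map {α γ : Type*} (φ : α → γ) {u : List α} {p : ℕ} (h : u.HasPeriod p) :
    (u.map φ).HasPeriod p := by
  unfold List.HasPeriod at *
  simpa [List.map_take] using h.map φ

theorem hasPeriod_reverse {α : Type*} {u : List α} {p : ℕ} (h : u.HasPeriod p) :
    u.reverse.HasPeriod p := by
  rw [List.hasPeriod_iff_getElem?] at *
  intro i hi
  rw [List.length_reverse] at hi
  rw [List.getElem?_reverse (by omega), List.getElem?_reverse (by omega),
    h (u.length - 1 - (i + p)) (by omega)]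
  congr 1
  omega

theorem HasPow.map {α γ : Type*} {e f : ℕ} {w : List α} (φ : α → γ) (h : HasPow e f w) :
    HasPow e f (w.map φ) := by
  obtain ⟨u, hu, p, hp, hper, hl⟩ := h
  exact ⟨u.map φ, hu.map φ, p, hp, hasPeriod_map φ hper, by simpa using hl⟩

theorem HasPow.reverse {α : Type*} {e f : ℕ} {w : List α} (h : HasPow e f w) :
    HasPow e f w.reverse := by
  obtain ⟨u, hu, p, hp, hper, hl⟩ := h
  exact ⟨u.reverse, List.reverse_infix.2 hu, p, hp, hasPeriod_reverse hper, by simpa using hl⟩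

theorem PowFree.map_equiv {α γ : Type*} {c d : ℕ} {w : List α} (φ : α ≃ γ) (h : PowFree c d w) :
    PowFree c d (w.map φ) := by
  intro u hu p hp hper
  have := h (u.map φ.symm) (by simpa using hu.map φ.symm) p hp (hasPeriod_map _ hper)
  simpa using this

theorem period_spec {α : Type*} (u : List α) : 1 ≤ period u ∧ u.HasPeriod (period u) := by
  have : {p : ℕ | 1 ≤ p ∧ u.HasPeriod p}.Nonempty :=
    ⟨u.length + 1, by omega, List.hasPeriod_of_length_le _ _ (by omega)⟩
  exact Nat.sInf_mem this

theorem PowFree.isFree {α : Type*} {c d : ℕ} {w : List α} {β : ExtReal} (h : PowFree c d w)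
    (hd : 0 < d) (hβ : ExtReal.plus (c / d) ≤ β) : IsFree β w := by
  rintro ⟨u, hu, hβu⟩
  have h1 := hβ.trans hβu
  have h2 : ¬ ExtReal.real (exponent u) < ExtReal.plus ((c : ℝ) / d) := not_lt.2 h1
  rw [ExtReal.real_lt_plus_iff] at h2
  apply h2
  obtain ⟨hp, hper⟩ := period_spec u
  have := h u hu _ hp hper
  unfold exponent
  rw [div_le_div_iff₀ (by exact_mod_cast hp) (by exact_mod_cast hd)]
  exact_mod_cast (by linarith : u.length * d ≤ c * period u)

/-- Any period will do as a witness: the least period can only increase the exponent. -/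
theorem HasPow.hasPower {α : Type*} {e f : ℕ} {w : List α} {β : ExtReal} (h : HasPow e f w)
    (hf : 0 < f) (hβ : β ≤ ExtReal.real (e / f)) : HasPower β w := by
  obtain ⟨u, hu, p, hp, hper, hl⟩ := h
  refine ⟨u, hu, hβ.trans ?_⟩
  have hle : period u ≤ p := Nat.sInf_le ⟨hp, hper⟩
  have hpos := (period_spec u).1
  have : (e : ℝ) / f ≤ exponent u := by
    unfold exponent
    rw [div_le_div_iff₀ (by exact_mod_cast hf) (by exact_mod_cast hpos)]
    have : e * period u ≤ u.length * f :=
      (Nat.mul_le_mul_left e hle).trans (by linarith)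
    exact_mod_cast this
  rw [ExtReal.real, ExtReal.real, Prod.Lex.toLex_le_toLex]
  rcases this.lt_or_eq with h | h
  · exact Or.inl h
  · exact Or.inr ⟨h, le_rfl⟩

/-- Whether the two words have a common prefix of length `n`. -/
def agree : ℕ → List Bool → List Bool → Bool
  | 0, _, _ => true
  | n + 1, a :: u, b :: v => (a == b) && agree n u v
  | _ + 1, _, _ => false

/-- Whether the two words have a common factor of length `n` at the same position. -/
def agreeSomewhere (n : ℕ) : List Bool → List Bool → Bool
  | a :: u, b :: v => agree n (a :: u) (b :: v) || agreeSomewhere n u v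
  | _, _ => false

/-- A test for `HasPow e f v` that only tries the periods in `ps`. -/
def powCheck (e f : ℕ) (ps : List ℕ) (v : List Bool) : Bool :=
  ps.any fun p => Nat.ble 1 p && Nat.ble p v.length &&
    agreeSomewhere ((e * p + f - 1) / f - p) v (v.drop p)

theorem agree_spec {n : ℕ} {u v : List Bool} (h : agree n u v = true) :
    n ≤ u.length ∧ n ≤ v.length ∧ ∀ j < n, u[j]? = v[j]? := by
  induction n generalizing u v with
  | zero => simp
  | succ n ih =>
    match u, v, h with
    | a :: u, b :: v, h =>
      simp only [agree, Bool.and_eq_true, beq_iff_eq] at h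
      obtain ⟨h1, h2, h3⟩ := ih h.2
      refine ⟨by simpa using h1, by simpa using h2, fun j hj => ?_⟩
      cases j with
      | zero => simp [h.1]
      | succ j => simpa using h3 j (by omega)

theorem agree_of_eq {n : ℕ} {u v : List Bool} (h : u = v) (hn : n ≤ u.length) :
    agree n u v = true := by
  subst h
  induction n generalizing u with
  | zero => rfl
  | succ n ih =>
    match u, hn with
    | a :: u, hn => simpa [agree] using ih (by simpa using hn)

theorem agreeSomewhere_spec {n : ℕ} {u v : List Bool} (h : agreeSomewhere n u v = true) :
    ∃ i, i + n ≤ u.length ∧ i + n ≤ v.length ∧ ∀ j < n, u[i + j]? = v[i + j]? := by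
  induction u generalizing v with
  | nil => simp [agreeSomewhere] at h
  | cons a u ih =>
    match v, h with
    | b :: v, h =>
      rw [agreeSomewhere, Bool.or_eq_true] at h
      rcases h with h | h
      · obtain ⟨h1, h2, h3⟩ := agree_spec h
        exact ⟨0, by omega, by omega, by simpa using h3⟩
      · obtain ⟨i, h1, h2, h3⟩ := ih h
        refine ⟨i + 1, by simp; omega, by simp; omega, fun j hj => ?_⟩
        rw [show i + 1 + j = i + j + 1 by omega]
        simpa using h3 j hj

/-- A run of `⌈e p / f⌉ - p` letters agreeing with those `p` places later spans a factor of period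
`p` and length at least `e p / f`; `(e * p + f - 1) / f` is that ceiling. -/
theorem hasPow_of_powCheck {e f : ℕ} {ps : List ℕ} {v : List Bool} (hf : 0 < f)
    (h : powCheck e f ps v = true) : HasPow e f v := by
  simp only [powCheck, List.any_eq_true, Bool.and_eq_true, Nat.ble_eq] at h
  obtain ⟨p, -, ⟨hp, hpv⟩, h⟩ := h
  obtain ⟨i, -, hle, heq⟩ := agreeSomewhere_spec h
  rw [List.length_drop] at hle
  set n := (e * p + f - 1) / f - p with hn
  refine ⟨(v.drop i).take (p + n), ?_, p, hp, ?_, ?_⟩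
  · exact (List.take_prefix _ _).isInfix.trans (List.drop_suffix _ _).isInfix
  · rw [List.hasPeriod_iff_getElem?]
    intro j hj
    rw [List.length_take] at hj
    have := heq j (by omega)
    rw [List.getElem?_drop] at this
    rw [List.getElem?_take, List.getElem?_take, if_pos (by omega), if_pos (by omega),
      List.getElem?_drop, List.getElem?_drop, this]
    congr 1
    omega
  · rw [List.length_take, List.length_drop, min_eq_left (by omega)]
    have h1 : e * p ≤ f * ((e * p + f - 1) / f) := by
      have := Nat.div_add_mod (e * p + f - 1) f
      have := Nat.mod_lt (e * p + f - 1) hf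
      omega
    exact h1.trans (Nat.mul_le_mul_left f (by omega))

/-! ### Windows of sequences -/

/-- The factor of length `l` at position `s` of the sequence `g`. -/
def window (g : ℕ → Bool) (s l : ℕ) : List Bool :=
  (List.range l).map fun i => g (s + i)

@[simp] theorem length_window (g : ℕ → Bool) (s l : ℕ) : (window g s l).length = l := by
  simp [window]

theorem getElem?_window (g : ℕ → Bool) {s l i : ℕ} (h : i < l) :
    (window g s l)[i]? = some (g (s + i)) := by
  simp [window, h]

theorem getD_window (g : ℕ → Bool) {s l i : ℕ} (h : i < l) :
    (window g s l).getD i false = g (s + i) := by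
  simp [List.getD, getElem?_window g h]

theorem window_add (g : ℕ → Bool) (s a b : ℕ) :
    window g s (a + b) = window g s a ++ window g (s + a) b := by
  simp [window, List.range_add, add_assoc, Function.comp_def]

theorem window_congr {g g' : ℕ → Bool} {s s' l : ℕ} (h : ∀ i < l, g (s + i) = g' (s' + i)) :
    window g s l = window g' s' l := by
  apply List.map_congr_left
  intro i hi
  exact h i (List.mem_range.1 hi)

/-- The image of the Thue–Morse sequence under the `q`-uniform morphism `h`. -/
def image (h : Bool → List Bool) (q n : ℕ) : Bool :=
  (h (thueMorse (n / q))).getD (n % q) false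

/-- The factors of length `l` at position `r` of the images of words of length three, with their
positions `r < q`. -/
def blockWindows (h : Bool → List Bool) (q l : ℕ) : List (ℕ × List Bool) :=
  (List.range q).flatMap fun r =>
    [false, true].flatMap fun x => [false, true].flatMap fun y => [false, true].map fun z =>
      (r, ((h x ++ h y ++ h z).drop r).take l)

theorem window_image {h : Bool → List Bool} {q : ℕ} (hq : ∀ x, (h x).length = q) (n l : ℕ)
    (hl : n % q + l ≤ 3 * q) :
    window (image h q) n l = ((h (thueMorse (n / q)) ++ h (thueMorse (n / q + 1)) ++
      h (thueMorse (n / q + 2))).drop (n % q)).take l := by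
  rcases Nat.eq_zero_or_pos q with rfl | hq0
  · obtain rfl : l = 0 := by omega
    simp [window]
  have hn := Nat.mod_add_div n q
  have key : ∀ i b, q * b ≤ n % q + i → n % q + i < q * b + q →
      (n + i) / q = n / q + b ∧ (n + i) % q = n % q + i - q * b := by
    intro i b h1 h2
    have e : n + i = (n % q + i - q * b) + q * (n / q + b) := by
      rw [mul_add]; omega
    constructor
    · rw [e, Nat.add_mul_div_left _ _ hq0, Nat.div_eq_of_lt (by omega), zero_add]
    · conv_lhs => rw [e]
      rw [Nat.add_mul_mod_self_left, Nat.mod_eq_of_lt (by omega)]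
  apply List.ext_getElem?
  intro i
  rcases lt_or_ge i l with hi | hi
  · rw [getElem?_window _ hi, List.getElem?_take, if_pos hi, List.getElem?_drop, image]
    have get : ∀ x j, j < q → some ((h x).getD j false) = (h x)[j]? := by
      intro x j hj
      rw [List.getD, List.getElem?_eq_getElem (by rw [hq]; exact hj)]
      rfl
    rcases lt_or_ge (n % q + i) q with h1 | h1
    · obtain ⟨e1, e2⟩ := key i 0 (by omega) (by omega)
      rw [e1, e2, get _ _ (by omega), List.append_assoc,
        List.getElem?_append_left (by rw [hq]; omega)]
      simp
    · rcases lt_or_ge (n % q + i) (2 * q) with h2 | h2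
      · obtain ⟨e1, e2⟩ := key i 1 (by omega) (by omega)
        rw [e1, e2, get _ _ (by omega), List.append_assoc,
          List.getElem?_append_right (by rw [hq]; omega),
          List.getElem?_append_left (by rw [hq, hq]; omega), hq, mul_one]
      · obtain ⟨e1, e2⟩ := key i 2 (by omega) (by omega)
        rw [e1, e2, get _ _ (by omega),
          List.getElem?_append_right (by rw [List.length_append, hq, hq]; omega),
          List.length_append, hq, hq, mul_two]
  · rw [List.getElem?_eq_none (by simpa using hi), List.getElem?_eq_none]
    rw [List.length_take]
    omega

/-- A factor of length at most `2q + 1` fits into three consecutive blocks, so statements about all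
factors become finite checks. All eight triples are kept, even those absent from Thue–Morse. -/
theorem window_mem_blockWindows {h : Bool → List Bool} {q : ℕ} (hq : ∀ x, (h x).length = q)
    (hq0 : 0 < q) (n : ℕ) {l : ℕ} (hl : l ≤ 2 * q + 1) :
    (n % q, window (image h q) n l) ∈ blockWindows h q l := by
  have hr := Nat.mod_lt n hq0
  rw [window_image hq n l (by omega)]
  simp only [blockWindows, List.mem_flatMap, List.mem_map, List.mem_range]
  refine ⟨_, hr, _, ?_, _, ?_, _, ?_, rfl⟩ <;> simp

end Word

namespace Word

/-- Every factor of the sequence `W` of period `p` has length at most `c / d * p`. -/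
def SeqPowFree (c d : ℕ) (W : ℕ → Bool) : Prop :=
  ∀ i p m, 1 ≤ p → (∀ j < m, W (i + j) = W (i + j + p)) → d * (m + p) ≤ c * p

/-! ### Words with a border on both sides -/

/-- The word `P` followed by the sequence `W` from position `s` on. -/
def prepend (P : List Bool) (W : ℕ → Bool) (s j : ℕ) : Bool :=
  if j < P.length then P.getD j false else W (s + (j - P.length))

/-- The sequence that starts with `P`, a factor of `W` of length `L` at position `s`, and the
reversed complement of `P`. -/
def bordered (P : List Bool) (W : ℕ → Bool) (s L j : ℕ) : Bool :=
  if j < P.length + L then prepend P W s j else !prepend P W s (2 * P.length + L - 1 - j)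

section Bordered

variable {P : List Bool} {W : ℕ → Bool} {s L : ℕ}

theorem bordered_of_lt {j : ℕ} (h : j < P.length + L) :
    bordered P W s L j = prepend P W s j := if_pos h

theorem bordered_mid {j : ℕ} (h : j < L) : bordered P W s L (P.length + j) = W (s + j) := by
  rw [bordered_of_lt (by omega), prepend, if_neg (by omega)]
  congr 2
  omega

theorem bordered_mirror (hW : ∀ i < L, W (s + (L - 1 - i)) = !W (s + i)) {j : ℕ}
    (hj : j < 2 * P.length + L) :
    bordered P W s L (2 * P.length + L - 1 - j) = !bordered P W s L j := by
  rcases lt_or_ge j P.length with h1 | h1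
  · rw [bordered, if_neg (by omega), bordered_of_lt (by omega)]
    congr 2
    omega
  · rcases lt_or_ge j (P.length + L) with h2 | h2
    · obtain ⟨i, rfl⟩ := Nat.exists_eq_add_of_le h1
      rw [show 2 * P.length + L - 1 - (P.length + i) = P.length + (L - 1 - i) by omega,
        bordered_mid (by omega), bordered_mid (by omega), hW i (by omega)]
    · rw [bordered_of_lt (by omega), bordered, if_neg (by omega), Bool.not_not]

/-- A power in a bordered word that starts in the left border is short, if its period is short or
if `P` contains, at each position, the beginning of a word that is not a factor of `W`. -/
theorem bordered_left_powFree {c d M p₀ : ℕ}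
    (hmark : ∀ i < P.length, ∀ n, ∃ j < M, W (n + j) ≠ prepend P W s (i + j))
    (hsmall : ∀ i < P.length, ∀ p, 1 ≤ p → p < p₀ →
      ∃ j, d * (j + p) ≤ c * p ∧ i + j + p < P.length + L ∧
        prepend P W s (i + j) ≠ prepend P W s (i + j + p))
    (hp₀ : P.length ≤ p₀)
    (hM : ∀ p m, p₀ ≤ p → c * p < d * (m + p) → M ≤ m ∧ p < m)
    (hL : 2 * (P.length + M) ≤ L) (i p m : ℕ) (hi : i < P.length) (hp : 1 ≤ p)
    (hN : i + m + p ≤ 2 * P.length + L)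
    (hper : ∀ j < m, bordered P W s L (i + j) = bordered P W s L (i + j + p)) :
    d * (m + p) ≤ c * p := by
  by_contra hlt
  rw [not_le] at hlt
  rcases lt_or_ge p p₀ with h | h
  · obtain ⟨j, hj, hjL, hne⟩ := hsmall i hi p hp h
    -- The power is too long for its period, so the prescribed mismatch falls inside it.
    have hjm : j < m := by
      by_contra hge
      exact absurd (Nat.mul_le_mul_left d (by omega : m + p ≤ j + p)) (by omega)
    have := hper j hjm
    rw [bordered_of_lt (by omega), bordered_of_lt (by omega)] at this
    exact hne this
  · obtain ⟨hMm, hpm⟩ := hM p m h hlt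
    -- The translate by `p` of the marker at `i` lies wholly in the middle part: `p ≥ P.length`
    -- clears the left border, while `p < m` and `hL` keep it off the right one.
    obtain ⟨j, hj, hne⟩ := hmark i hi (s + (i + p - P.length))
    have := hper j (by omega)
    rw [bordered_of_lt (by omega),
      show i + j + p = P.length + (i + p - P.length + j) by omega,
      bordered_mid (by omega)] at this
    rw [add_assoc] at hne
    exact hne this.symm

theorem bordered_powFree {c d M p₀ : ℕ} (hfree : SeqPowFree c d W)
    (hW : ∀ i < L, W (s + (L - 1 - i)) = !W (s + i))
    (hmark : ∀ i < P.length, ∀ n, ∃ j < M, W (n + j) ≠ prepend P W s (i + j))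
    (hsmall : ∀ i < P.length, ∀ p, 1 ≤ p → p < p₀ →
      ∃ j, d * (j + p) ≤ c * p ∧ i + j + p < P.length + L ∧
        prepend P W s (i + j) ≠ prepend P W s (i + j + p))
    (hp₀ : P.length ≤ p₀)
    (hM : ∀ p m, p₀ ≤ p → c * p < d * (m + p) → M ≤ m ∧ p < m)
    (hL : 2 * (P.length + M) ≤ L) (i p m : ℕ) (hp : 1 ≤ p)
    (hN : i + m + p ≤ 2 * P.length + L)
    (hper : ∀ j < m, bordered P W s L (i + j) = bordered P W s L (i + j + p)) :
    d * (m + p) ≤ c * p := by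
  have left := bordered_left_powFree hmark hsmall hp₀ hM hL
  rcases lt_or_ge i P.length with h1 | h1
  · exact left i p m h1 hp hN hper
  rcases le_or_gt (i + m + p) (P.length + L) with h2 | h2
  · obtain ⟨n, rfl⟩ := Nat.exists_eq_add_of_le h1
    refine hfree (s + n) p m hp fun j hj => ?_
    have := hper j hj
    rwa [add_assoc P.length, bordered_mid (by omega), add_assoc P.length,
      bordered_mid (by omega), ← add_assoc, ← add_assoc, ← add_assoc] at this
  -- A power reaching the right border is reflected into one starting in the left border.
  · refine left (2 * P.length + L - (i + m + p)) p m (by omega) hp (by omega) fun j hj => ?_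
    have := hper (m - 1 - j) (by omega)
    rw [← Bool.not_inj_iff, ← bordered_mirror hW (by omega), ← bordered_mirror hW (by omega)]
      at this
    convert this.symm using 2 <;> omega

theorem powFree_window {g : ℕ → Bool} {c d N : ℕ}
    (h : ∀ i p m, 1 ≤ p → i + m + p ≤ N → (∀ j < m, g (i + j) = g (i + j + p)) →
      d * (m + p) ≤ c * p) (hcd : d ≤ c) : PowFree c d (window g 0 N) := by
  rintro u ⟨a, b, hab⟩ p hp hper
  -- `HasPeriod p` is vacuous for words of length at most `p`; there the bound is just `d ≤ c`.
  rcases le_or_gt u.length p with hle | hlt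
  · exact Nat.mul_le_mul hcd hle
  have hlen := congrArg List.length hab
  simp only [List.length_append, length_window] at hlen
  have get : ∀ j < u.length, u[j]? = some (g (a.length + j)) := by
    intro j hj
    have h1 := getElem?_window g (s := 0) (by omega : a.length + j < N)
    rw [← hab, List.append_assoc, List.getElem?_append_right (by omega),
      List.getElem?_append_left (by omega), zero_add, Nat.add_sub_cancel_left] at h1
    exact h1
  rw [List.hasPeriod_iff_getElem?] at hper
  have := h a.length p (u.length - p) hp (by omega) fun j hj => by
    have := hper j hj
    rw [get _ (by omega), get _ (by omega), Option.some_inj, ← add_assoc] at this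
    exact this
  rwa [Nat.sub_add_cancel hlt.le] at this

/-- Inserting a letter into a word inserts it into every factor that meets the position. -/
theorem insert_infix {α : Type*} {A B C w₁ w₂ : List α} (a : α) (h : A ++ B ++ C = w₁ ++ w₂)
    (h₁ : A.length ≤ w₁.length) (h₂ : w₁.length ≤ A.length + B.length) :
    B.take (w₁.length - A.length) ++ a :: B.drop (w₁.length - A.length) <:+:
      w₁ ++ a :: w₂ := by
  obtain ⟨i, hi⟩ : ∃ i, i = w₁.length - A.length := ⟨_, rfl⟩
  rw [← hi]
  have e : (A ++ B.take i) ++ (B.drop i ++ C) = w₁ ++ w₂ := by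
    rw [← h, List.append_assoc, ← List.append_assoc (B.take i), List.take_append_drop,
      List.append_assoc]
  obtain ⟨e₁, e₂⟩ := List.append_inj e (by simp; omega)
  exact ⟨A, C, by simp [← e₁, ← e₂]⟩

theorem window_bordered_mirror (hW : ∀ i < L, W (s + (L - 1 - i)) = !W (s + i)) :
    (window (bordered P W s L) 0 (2 * P.length + L)).reverse.map (!·) =
      window (bordered P W s L) 0 (2 * P.length + L) := by
  apply List.ext_getElem?
  intro j
  rcases lt_or_ge j (2 * P.length + L) with hj | hj
  · rw [List.getElem?_map, List.getElem?_reverse (by simpa using hj), length_window,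
      getElem?_window _ (by omega), getElem?_window _ hj, Option.map_some, zero_add, zero_add,
      bordered_mirror hW hj, Bool.not_not]
  · rw [List.getElem?_eq_none (by simpa using hj), List.getElem?_eq_none (by simpa using hj)]

theorem hasPow_insert_bordered {e f q : ℕ}
    (hW : ∀ i < L, W (s + (L - 1 - i)) = !W (s + i))
    (hpre : ∀ i < P.length + q, ∀ a, HasPow e f
      ((window (prepend P W s) 0 (P.length + 2 * q)).take i ++
        a :: (window (prepend P W s) 0 (P.length + 2 * q)).drop i))
    (hmid : ∀ n a, HasPow e f ((window W n (2 * q)).take q ++ a :: (window W n (2 * q)).drop q))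
    (hL : 2 * q ≤ L) (x : List Bool)
    (hx : IsExtension (window (bordered P W s L) 0 (2 * P.length + L)) x) : HasPow e f x := by
  have half : ∀ w₁ w₂ a, window (bordered P W s L) 0 (2 * P.length + L) = w₁ ++ w₂ →
      2 * w₁.length ≤ 2 * P.length + L → HasPow e f (w₁ ++ a :: w₂) := by
    intro w₁ w₂ a hw hle
    rcases lt_or_ge w₁.length (P.length + q) with h | h
    · have hdec : ([] : List Bool) ++ window (prepend P W s) 0 (P.length + 2 * q) ++
          window (bordered P W s L) (P.length + 2 * q) (P.length + L - 2 * q) = w₁ ++ w₂ := by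
        have hcongr : window (prepend P W s) 0 (P.length + 2 * q) =
            window (bordered P W s L) 0 (P.length + 2 * q) :=
          window_congr fun i hi => (bordered_of_lt (by omega)).symm
        have hadd := window_add (bordered P W s L) 0 (P.length + 2 * q) (P.length + L - 2 * q)
        rw [zero_add] at hadd
        rw [← hw, hcongr, List.nil_append, ← hadd]
        congr 1
        omega
      have := insert_infix a hdec (by simp) (by simp; omega)
      exact (hpre w₁.length h a).mono this
    -- The insertion point is the centre of a window of `2q` letters of `W`, which avoids the right
    -- border because the point is in the left half.
    · obtain ⟨n, hn⟩ := Nat.exists_eq_add_of_le h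
      have hdec : window (bordered P W s L) 0 (P.length + n) ++ window W (s + n) (2 * q) ++
          window (bordered P W s L) (P.length + n + 2 * q) (P.length + L - n - 2 * q) =
            w₁ ++ w₂ := by
        have hcongr : window W (s + n) (2 * q) =
            window (bordered P W s L) (P.length + n) (2 * q) :=
          window_congr fun i hi => by
            rw [add_assoc P.length, bordered_mid (by omega), add_assoc]
        have hadd := window_add (bordered P W s L) 0 (P.length + n + 2 * q)
          (P.length + L - n - 2 * q)
        rw [window_add _ 0 (P.length + n), zero_add, zero_add] at hadd
        rw [← hw, hcongr, ← hadd]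
        congr 1
        omega
      have := insert_infix a hdec (by simp; omega) (by simp; omega)
      rw [length_window, show w₁.length - (P.length + n) = q by omega] at this
      exact (hmid (s + n) a).mono this
  obtain ⟨w₁, w₂, a, hw, rfl⟩ := hx
  rcases le_or_gt (2 * w₁.length) (2 * P.length + L) with h | h
  · exact half w₁ w₂ a hw h
  · have hlen := congrArg List.length hw
    simp only [List.length_append, length_window] at hlen
    have hrev := half (w₂.reverse.map (!·)) (w₁.reverse.map (!·)) (!a)
      (by rw [← window_bordered_mirror hW, hw]; simp) (by simp; omega)
    have := (hrev.map (!·)).reverse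
    simpa [Function.comp_def] using this

end Bordered

/-- Existence of long extremal words from finitely many checks: the border `P` is put in front of
a sequence `W` that is the image of the Thue–Morse sequence under a `q`-uniform morphism. -/
theorem exists_extremal_of_checks {c d e f M p₀ q s : ℕ} {h : Bool → List Bool} {P : List Bool}
    {ps : List ℕ} (hq : ∀ x, (h x).length = q) (hq0 : 0 < q) (hf : 0 < f) (hcd : d ≤ c)
    (hs : s < q) (hfree : SeqPowFree c d (image h q))
    (hmirror : ∀ B, ∃ L ≥ B, ∀ i < L, image h q (s + (L - 1 - i)) = !image h q (s + i))
    (hp₀ : P.length ≤ p₀) (hsq : p₀ + M ≤ 2 * q)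
    (hM : ∀ p m, p₀ ≤ p → c * p < d * (m + p) → M ≤ m ∧ p < m)
    (V : List Bool) (hV : V = P ++ ((h false ++ h true ++ h true).drop s).take (2 * q))
    (hmark : ∀ rv ∈ blockWindows h q M, ∀ i < P.length, rv.2 ≠ (V.drop i).take M)
    (hsmall : ∀ i < P.length, ∀ p < p₀, 1 ≤ p → ∃ j < 2 * q, d * (j + p) ≤ c * p ∧
      i + j + p < V.length ∧ V.getD (i + j) false ≠ V.getD (i + j + p) false)
    (hpre : ∀ i < P.length + q, ∀ a, powCheck e f ps (V.take i ++ a :: V.drop i) = true)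
    (hmid : ∀ rv ∈ blockWindows h q (2 * q), ∀ a,
      HasPow e f (rv.2.take q ++ a :: rv.2.drop q)) (N : ℕ) :
    ∃ w : List Bool, N ≤ w.length ∧ PowFree c d w ∧ ∀ x, IsExtension w x → HasPow e f x := by
  obtain ⟨L, hL, hW⟩ := hmirror (N + 2 * (P.length + M) + 4 * q)
  have hVw : V = window (prepend P (image h q) s) 0 (P.length + 2 * q) := by
    rw [hV, window_add]
    congr 1
    · apply List.ext_getElem?
      intro i
      rcases lt_or_ge i P.length with hi | hi
      · rw [getElem?_window _ hi, prepend, zero_add, if_pos hi, List.getD,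
          List.getElem?_eq_getElem hi]
        rfl
      · rw [List.getElem?_eq_none hi, List.getElem?_eq_none (by simpa using hi)]
    · have := window_image hq s (2 * q) (by rw [Nat.mod_eq_of_lt hs]; omega)
      -- Since `s < q`, these `2q` letters lie in the images of the first three Thue–Morse letters
      -- `0, 1, 1`.
      have t1 : thueMorse 1 = true := by
        rw [show 1 = 2 * 0 + 1 from rfl, thueMorse_two_mul_add_one, thueMorse_zero, Bool.not_false]
      have t2 : thueMorse 2 = true := (thueMorse_two_mul 1).trans t1
      rw [Nat.div_eq_of_lt hs, Nat.mod_eq_of_lt hs, zero_add, zero_add,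
        thueMorse_zero, t1, t2] at this
      rw [← this]
      refine window_congr fun i _ => ?_
      rw [prepend, if_neg (by omega)]
      congr 1
      omega
  have hVlen : V.length = P.length + 2 * q := by rw [hVw, length_window]
  have hVget : ∀ j < P.length + 2 * q, V.getD j false = prepend P (image h q) s j := by
    intro j hj
    rw [hVw, getD_window _ hj, zero_add]
  refine ⟨window (bordered P (image h q) s L) 0 (2 * P.length + L), by simp; omega,
    powFree_window (bordered_powFree (M := M) (p₀ := p₀) hfree hW ?_ ?_ hp₀ hM (by omega)) hcd,
    hasPow_insert_bordered (q := q) hW ?_ ?_ (by omega)⟩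
  · intro i hi n
    by_contra hcon
    push Not at hcon
    refine hmark _ (window_mem_blockWindows hq hq0 n (by omega)) i hi ?_
    apply List.ext_getElem?
    intro j
    rcases lt_or_ge j M with hj | hj
    · rw [getElem?_window _ hj, List.getElem?_take, if_pos hj, List.getElem?_drop, hVw,
        getElem?_window _ (by omega), zero_add, hcon j hj]
    · rw [List.getElem?_eq_none (by simpa using hj), List.getElem?_eq_none (by simp; omega)]
  · intro i hi p hp hpp
    obtain ⟨j, -, hj, hlt, hne⟩ := hsmall i hi p hpp hp
    rw [hVlen] at hlt
    rw [hVget _ (by omega), hVget _ (by omega)] at hne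
    exact ⟨j, hj, by omega, hne⟩
  · intro i hi a
    rw [← hVw]
    exact hasPow_of_powCheck hf (hpre i hi a)
  · intro n a
    exact hmid _ (window_mem_blockWindows hq hq0 n (by omega)) a

end Word

namespace Word

/-! ### The Thue–Morse sequence itself -/

/-- The third power of the Thue–Morse morphism. -/
def thueMorseBlock (x : Bool) : List Bool :=
  [x, !x, !x, x, !x, x, x, !x]

theorem image_thueMorseBlock (n : ℕ) : image thueMorseBlock 8 n = thueMorse n := by
  obtain ⟨a, r, hr, rfl⟩ : ∃ a r, r < 8 ∧ n = 8 * a + r :=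
    ⟨n / 8, n % 8, Nat.mod_lt _ (by omega), by omega⟩
  rw [image, show (8 * a + r) / 8 = a by omega, show (8 * a + r) % 8 = r by omega]
  have h0 : thueMorse (8 * a) = thueMorse a := by
    rw [show 8 * a = 2 * (2 * (2 * a)) by ring, thueMorse_two_mul, thueMorse_two_mul,
      thueMorse_two_mul]
  have h4 : thueMorse (8 * a + 4) = !thueMorse a := by
    rw [show 8 * a + 4 = 2 * (2 * (2 * a + 1)) by ring, thueMorse_two_mul, thueMorse_two_mul,
      thueMorse_two_mul_add_one]
  have h2 : thueMorse (8 * a + 2) = !thueMorse a := by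
    rw [show 8 * a + 2 = 2 * (2 * (2 * a) + 1) by ring, thueMorse_two_mul,
      thueMorse_two_mul_add_one, thueMorse_two_mul]
  have h6 : thueMorse (8 * a + 6) = thueMorse a := by
    rw [show 8 * a + 6 = 2 * (2 * (2 * a + 1) + 1) by ring, thueMorse_two_mul,
      thueMorse_two_mul_add_one, thueMorse_two_mul_add_one, Bool.not_not]
  have odd : ∀ k, thueMorse (8 * a + (2 * k + 1)) = !thueMorse (8 * a + 2 * k) := by
    intro k
    rw [show 8 * a + (2 * k + 1) = 2 * (4 * a + k) + 1 by ring,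
      show 8 * a + 2 * k = 2 * (4 * a + k) by ring, thueMorse_two_mul_add_one, thueMorse_two_mul]
  interval_cases r
  · exact h0.symm
  · rw [odd 0, mul_zero, add_zero, h0]; rfl
  · exact h2.symm
  · rw [odd 1, h2]; simp [thueMorseBlock]
  · exact h4.symm
  · rw [odd 2, h4]; simp [thueMorseBlock]
  · exact h6.symm
  · rw [odd 3, h6]; rfl

theorem seqPowFree_thueMorse : SeqPowFree 2 1 thueMorse := by
  intro i p m hp hper
  by_contra hlt
  exact thueMorse_overlap_free p i hp fun j hj => hper j (by omega)

theorem powCheck_insert_thueMorseBlock : ∀ rv ∈ blockWindows thueMorseBlock 8 (2 * 8), ∀ a,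
    powCheck 7 3 [1, 2, 3] (rv.2.take 8 ++ a :: rv.2.drop 8) = true := by
  decide +kernel

/-- The word begins with `001001`, the border `0` followed by Thue–Morse from position 3. Prepending
`0` gives `000`, and prepending `1` gives `1001001`, of exponent `7/3`. -/
theorem exists_extremal_two_sevenThirds (N : ℕ) :
    ∃ w : List Bool, N ≤ w.length ∧ PowFree 2 1 w ∧ ∀ x, IsExtension w x → HasPow 7 3 x := by
  refine exists_extremal_of_checks (q := 8) (h := thueMorseBlock) (P := [false]) (s := 3)
    (M := 6) (p₀ := 5) (ps := [1, 2, 3, 4]) (fun _ => rfl) (by omega) (by omega) (by omega)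
    (by omega) ?_ ?_ (by simp) (by omega) (by omega) _ rfl
    (by decide +kernel) (by decide +kernel) (by decide +kernel)
    (fun rv hrv a => hasPow_of_powCheck (by omega) (powCheck_insert_thueMorseBlock rv hrv a)) N
  · rw [funext image_thueMorseBlock]
    exact seqPowFree_thueMorse
  · intro B
    -- A prefix of length `2 ^ n` is its own reversed complement when `n` is odd; dropping three
    -- letters at each end preserves this and starts at `s = 3`.
    have hpow : B + 6 < 2 ^ (2 * (B + 6) + 1) :=
      lt_of_lt_of_le (Nat.lt_two_pow_self) (Nat.pow_le_pow_right (by omega) (by omega))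
    refine ⟨2 ^ (2 * (B + 6) + 1) - 6, by omega, fun i hi => ?_⟩
    rw [image_thueMorseBlock, image_thueMorseBlock,
      thueMorse_mirror (2 * (B + 6) + 1) (3 + i) _ (by omega)]
    simp [Nat.add_mod]

/-! ### An image of the Thue–Morse sequence without powers of exponent above `7/3` -/

/-- A `25`-uniform morphism: inserting a letter into the images of words always creates a power of
exponent at least `8/3`. -/
def denseBlock : Bool → List Bool
  | false => [0, 1, 1, 0, 0, 1, 0, 0, 1, 1, 0, 1, 1, 0, 0, 1, 0, 0, 1, 1, 0, 1, 0, 0, 1].map (· == 1)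
  | true => [0, 1, 1, 0, 1, 0, 0, 1, 1, 0, 1, 1, 0, 0, 1, 0, 0, 1, 1, 0, 1, 1, 0, 0, 1].map (· == 1)

theorem length_denseBlock (x : Bool) : (denseBlock x).length = 25 := by
  cases x <;> rfl

/-- Synchronization: equal factors of length 19 occupy the same position modulo 25, which forces
long periods to be multiples of 25. -/
theorem denseBlock_sync_check : ((blockWindows denseBlock 25 19).all fun rv =>
    (blockWindows denseBlock 25 19).all fun rv' =>
      (Nat.beq rv.1 rv'.1) || !(agree 19 rv.2 rv'.2)) = true := by
  decide +kernel

theorem denseBlock_sync {rv rv' : ℕ × List Bool} (h : rv ∈ blockWindows denseBlock 25 19)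
    (h' : rv' ∈ blockWindows denseBlock 25 19) (heq : agree 19 rv.2 rv'.2 = true) :
    rv.1 = rv'.1 := by
  have := List.all_eq_true.1 (List.all_eq_true.1 denseBlock_sync_check rv h) rv' h'
  simpa [heq] using this

theorem denseBlock_short_periods : ∀ rv ∈ blockWindows denseBlock 25 33, ∀ p < 14, 1 ≤ p →
    ∃ j < 19, 3 * (j + p) ≤ 7 * p ∧ rv.2.getD j false ≠ rv.2.getD (j + p) false := by
  decide +kernel

theorem denseBlock_getD_four (x : Bool) : (denseBlock x).getD 4 false = x := by
  cases x <;> rfl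

theorem denseBlock_getD_twenty (x : Bool) : (denseBlock x).getD 20 false = x := by
  cases x <;> rfl

theorem denseBlock_mirror : ∀ r < 25, ∀ x : Bool,
    (denseBlock !x).getD (24 - r) false = !(denseBlock x).getD r false := by
  decide +kernel

theorem seqPowFree_denseBlock : SeqPowFree 7 3 (image denseBlock 25) := by
  intro i p m hp hper
  by_contra hlt
  rw [not_le] at hlt
  rcases lt_or_ge p 14 with h | h
  · obtain ⟨j, hj, hle, hne⟩ := denseBlock_short_periods _
      (window_mem_blockWindows length_denseBlock (by omega) i (by omega)) p h hp
    rw [getD_window _ (by omega), getD_window _ (by omega), ← add_assoc] at hne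
    exact hne (hper j (by omega))
  -- Exponent above `7/3` with `p ≥ 14` gives `m ≥ 19`, enough to synchronize.
  · have hmod : i % 25 = (i + p) % 25 := denseBlock_sync
      (window_mem_blockWindows length_denseBlock (by omega) i (by omega))
      (window_mem_blockWindows length_denseBlock (by omega) (i + p) (by omega))
      (agree_of_eq (window_congr fun j hj => by rw [hper j (by omega)]; congr 1; omega)
        (length_window _ _ _).ge)
    obtain ⟨k, rfl⟩ : ∃ k, p = 25 * k := ⟨p / 25, by omega⟩
    have h4 : ∀ a, image denseBlock 25 (25 * a + 4) = thueMorse a := by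
      intro a
      rw [image, show (25 * a + 4) / 25 = a by omega, show (25 * a + 4) % 25 = 4 by omega,
        denseBlock_getD_four]
    have h20 : ∀ a, image denseBlock 25 (25 * a + 20) = thueMorse a := by
      intro a
      rw [image, show (25 * a + 20) / 25 = a by omega, show (25 * a + 20) % 25 = 20 by omega,
        denseBlock_getD_twenty]
    have hper' : ∀ n, i ≤ n → n < i + m →
        image denseBlock 25 n = image denseBlock 25 (n + 25 * k) := by
      intro n h1 h2
      obtain ⟨j, rfl⟩ := Nat.exists_eq_add_of_le h1
      exact hper j (by omega)
    -- Letters 4 and 20 of a block each reveal its Thue–Morse letter. The first block may be cut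
    -- before position `i`, so it is read at letter 20 and the others at letter 4; `m > 4p/3` leaves
    -- room for all `k + 1` blocks of an overlap.
    refine thueMorse_overlap_free k ((i + 4) / 25) (by omega) fun j hj => ?_
    rcases Nat.eq_zero_or_pos j with rfl | hj0
    · have := hper' (25 * ((i + 4) / 25) + 20) (by omega) (by omega)
      rwa [h20, show 25 * ((i + 4) / 25) + 20 + 25 * k = 25 * ((i + 4) / 25 + 0 + k) + 20 by omega,
        h20] at this
    · have := hper' (25 * ((i + 4) / 25 + j) + 4) (by omega) (by omega)
      rwa [h4, show 25 * ((i + 4) / 25 + j) + 4 + 25 * k = 25 * ((i + 4) / 25 + j + k) + 4 by omega,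
        h4] at this

theorem exists_mirror_denseBlock (B : ℕ) : ∃ L ≥ B, ∀ i < L,
    image denseBlock 25 (0 + (L - 1 - i)) = !image denseBlock 25 (0 + i) := by
  have hpow : B < 2 ^ (2 * B + 1) :=
    lt_of_lt_of_le (Nat.lt_two_pow_self) (Nat.pow_le_pow_right (by omega) (by omega))
  refine ⟨25 * 2 ^ (2 * B + 1), by omega, fun i hi => ?_⟩
  have hdiv : (25 * 2 ^ (2 * B + 1) - 1 - i) / 25 = 2 ^ (2 * B + 1) - 1 - i / 25 := by omega
  have hmod : (25 * 2 ^ (2 * B + 1) - 1 - i) % 25 = 24 - i % 25 := by omega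
  rw [zero_add, zero_add, image, image, hdiv, hmod,
    thueMorse_mirror (2 * B + 1) (i / 25) _ (by omega)]
  simpa [Nat.add_mod] using denseBlock_mirror (i % 25) (Nat.mod_lt _ (by omega)) (thueMorse (i / 25))

theorem powCheck_insert_denseBlock : ∀ rv ∈ blockWindows denseBlock 25 (2 * 25), ∀ a,
    powCheck 8 3 [1, 2, 3, 4, 10] (rv.2.take 25 ++ a :: rv.2.drop 25) = true := by
  decide +kernel

end Word

/-! ### Borders for the three upper intervals -/

namespace Word

/-- Existence of long extremal words made of a border and a factor of the image of the Thue–Morse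
sequence under `denseBlock`. -/
theorem exists_extremal_of_border {c d e f : ℕ} (P V : List Bool) (hf : 0 < f)
    (hcd : 7 * d ≤ 3 * c) (hef : e * 3 ≤ 8 * f) (hP : P.length ≤ 14)
    (hM : ∀ p m, 14 ≤ p → c * p < d * (m + p) → 12 ≤ m ∧ p < m)
    (hV : V = P ++ (denseBlock false ++ denseBlock true))
    (hmark : ∀ rv ∈ blockWindows denseBlock 25 12, ∀ i < P.length, rv.2 ≠ (V.drop i).take 12)
    (hsmall : ∀ i < P.length, ∀ p < 14, 1 ≤ p → ∃ j < 50, d * (j + p) ≤ c * p ∧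
      i + j + p < V.length ∧ V.getD (i + j) false ≠ V.getD (i + j + p) false)
    (hpre : ∀ i < P.length + 25, ∀ a,
      powCheck e f [1, 2, 3, 4, 7, 10] (V.take i ++ a :: V.drop i) = true) (N : ℕ) :
    ∃ w : List Bool, N ≤ w.length ∧ PowFree c d w ∧ ∀ x, IsExtension w x → HasPow e f x := by
  refine exists_extremal_of_checks (q := 25) (s := 0) (M := 12) (p₀ := 14) length_denseBlock
    (by omega) hf (by omega) (by omega) ?_ exists_mirror_denseBlock hP (by omega) hM
    V hV hmark hsmall hpre (fun rv hrv a => ?_) N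
  · intro i p m hp hper
    have := seqPowFree_denseBlock i p m hp hper
    nlinarith [Nat.mul_le_mul_left d this, Nat.mul_le_mul_right p hcd]
  · exact (hasPow_of_powCheck (by omega) (powCheck_insert_denseBlock rv hrv a)).weaken
      (by omega) hef

/-- The word begins with a power of period 7 and length 16. Prepending `1` lengthens it to 17;
prepending `0` creates `01001001`, of exponent `8/3`. -/
theorem exists_extremal_sevenThirds (N : ℕ) :
    ∃ w : List Bool, N ≤ w.length ∧ PowFree 7 3 w ∧ ∀ x, IsExtension w x → HasPow 17 7 x :=
  exists_extremal_of_border ([1, 0, 0, 1, 0].map (· == 1)) _ (by omega) (by omega) (by omega)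
    (by decide) (by omega) rfl (by decide +kernel) (by decide +kernel)
    (by decide +kernel) N

/-- The border is the previous one preceded by `1`, so the initial power has exponent exactly
`17/7`. Prepending `0` makes it `18/7`; prepending `1` gives `111`. -/
theorem exists_extremal_seventeenSevenths (N : ℕ) :
    ∃ w : List Bool, N ≤ w.length ∧ PowFree 17 7 w ∧ ∀ x, IsExtension w x → HasPow 18 7 x :=
  exists_extremal_of_border ([1, 1, 0, 0, 1, 0].map (· == 1)) _ (by omega) (by omega) (by omega)
    (by decide) (by omega) rfl (by decide +kernel) (by decide +kernel)
    (by decide +kernel) N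

/-- The border is the square of `0110110`, which continues into `W` to length 18. Prepending `0`
gives exponent `19/7 > 8/3`; prepending `1` gives `10110110`, of exponent `8/3`. -/
theorem exists_extremal_eighteenSevenths (N : ℕ) :
    ∃ w : List Bool, N ≤ w.length ∧ PowFree 18 7 w ∧ ∀ x, IsExtension w x → HasPow 8 3 x :=
  exists_extremal_of_border ([0, 1, 1, 0, 1, 1, 0, 0, 1, 1, 0, 1, 1, 0].map (· == 1)) _ (by omega)
    (by omega) (by omega) (by decide) (by omega) rfl (by decide +kernel)
    (by decide +kernel) (by decide +kernel) N

/-! ### Extremal words over the binary alphabet -/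

theorem exists_isExtremalFree {c d e f : ℕ} {β : ExtReal} (hd : 0 < d) (hf : 0 < f)
    (h₁ : ExtReal.plus (c / d) ≤ β) (h₂ : β ≤ ExtReal.real (e / f)) {N : ℕ}
    (h : ∃ w : List Bool, N ≤ w.length ∧ PowFree c d w ∧ ∀ x, IsExtension w x → HasPow e f x) :
    ∃ w : List (Fin 2), N ≤ w.length ∧ IsExtremalFree β w := by
  obtain ⟨w, hN, hfree, hext⟩ := h
  refine ⟨w.map finTwoEquiv.symm, by simpa using hN, (hfree.map_equiv _).isFree hd h₁, ?_⟩
  rintro x ⟨w₁, w₂, a, hw, rfl⟩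
  have := (hext (w₁.map finTwoEquiv ++ finTwoEquiv a :: w₂.map finTwoEquiv)
    ⟨_, _, _, by rw [← List.map_append, ← hw]; simp, rfl⟩).map finTwoEquiv.symm
  simp only [List.map_append, List.map_cons, List.map_map, Equiv.symm_comp_self, List.map_id,
    Equiv.symm_apply_apply] at this
  exact this.hasPower hf h₂

theorem le_real_or_plus_le (x : ℝ) (β : ExtReal) : β ≤ ExtReal.real x ∨ ExtReal.plus x ≤ β := by
  rcases le_or_gt β (ExtReal.real x) with h | h
  · exact Or.inl h
  · exact Or.inr ((ExtReal.real_covBy_plus x).ge_of_gt h)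

end Word

theorem theorem1p3 (β : ExtReal) (hβ₁ : ExtReal.plus 2 ≤ β) (hβ₂ : β ≤ ExtReal.real (8 / 3)) :
    ∀ N : ℕ, ∃ w : List (Fin 2), N ≤ w.length ∧ Word.IsExtremalFree β w := by
  intro N
  rcases Word.le_real_or_plus_le (7 / 3) β with h₁ | h₁
  · exact Word.exists_isExtremalFree (c := 2) (d := 1) (e := 7) (f := 3) one_pos (by omega)
      (by simpa using hβ₁) (by exact_mod_cast h₁) (Word.exists_extremal_two_sevenThirds N)
  rcases Word.le_real_or_plus_le (17 / 7) β with h₂ | h₂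
  · exact Word.exists_isExtremalFree (c := 7) (d := 3) (e := 17) (f := 7) (by omega) (by omega)
      (by exact_mod_cast h₁) (by exact_mod_cast h₂) (Word.exists_extremal_sevenThirds N)
  rcases Word.le_real_or_plus_le (18 / 7) β with h₃ | h₃
  · exact Word.exists_isExtremalFree (c := 17) (d := 7) (e := 18) (f := 7) (by omega) (by omega)
      (by exact_mod_cast h₂) (by exact_mod_cast h₃) (Word.exists_extremal_seventeenSevenths N)
  · exact Word.exists_isExtremalFree (c := 18) (d := 7) (e := 8) (f := 3) (by omega) (by omega)
      (by exact_mod_cast h₃) (by exact_mod_cast hβ₂) (Word.exists_extremal_eighteenSevenths N)
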